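/- **Setting.** Let $1\le d\le T$ and $n$ be integers. For a $d$-dimensional subspace $\mathbf U\subseteq\mathbb R^n$ let $P_{\mathbf U}$ be the orthogonal projection onto $\mathbf U$ and $P_{\mathbf U}^\perp=I_n-P_{\mathbf U}$; the chordal distance on the Grassmannian $\mathrm{Gr}(n,d)$ is $d_2(\mathbf U,\mathbf V)=\big(\mathrm{tr}(P_{\mathbf U}^\perp P_{\mathbf V})\big)^{1/2}$, and $\mathbb B_r(\mathbf U)=\{\mathbf V: d_2(\mathbf U,\mathbf V)\le r\}$. Points of $\mathrm{Gr}(n,d)$ are represented by matrices $Y\in\mathbb R^{n\times d}$ with $Y^\top Y=I_d$, tangent vectors by $V\in\mathbb R^{n\times d}$ with $Y^\top V=0$, and the Riemannian metric is given by the Frobenius inner product; $\mathrm{grad}$ is the Riemannian gradient, represented by $\mathrm{grad} f=P^\perp\nabla\bar f(Y)$ for any differentiable extension $\bar f$ of $f$, and $\mathrm{Exp}$ is the exponential map, so that $\mathrm{Exp}_{\mathbf U}(\mathbf V)$ is represented by $(YQ_2\cos\Sigma+Q_1\sin\Sigma)Q_2^\top$ if $V=Q_1\Sigma Q_2^\top$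 is a compact SVD. Denote by $\sigma_i(A)$ the $i$-th largest singular value of $A$. **Assumptions.** Let $\mathbf U_t\in\mathrm{Gr}(n,d)$ and $u_t\in\mathbb R^n$, $t=1,2,\dots$, be such that 1. $u_t=\bar u_t+e_t$ with $\bar u_t\in\mathbf U_t$ and $\|e_t\|_2\le\epsilon$ for all $t\ge1$; 2. $d_2(\mathbf U_t,\mathbf U_{t+1})\le c$ for all $t\ge 1$, where $c\ge0$; 3. with $W_t=[u_{t-T+1}\ \dots\ u_t]\in\mathbb R^{n\times T}$ and constants $0<\underline\sigma\le\overline\sigma$, one has $\sigma_1(P_{\mathbf U_t}W_t)\le\overline\sigma$ and $\sigma_d(P_{\mathbf U_t}W_t)\ge\underline\sigma$ for all $t\ge T$. Let $\alpha>0$, $F_{W}(\mathbf V)=\|P_{\mathbf V}^\perp W\|_F^2$, and let $\hat{\mathbf U}_{t,k}\in\mathrm{Gr}(n,d)$ satisfy $$\hat{\mathbf U}_{t,k+1}=\mathrm{Exp}_{\hat{\mathbf U}_{t,k}}\big(-\alpha\,\mathrm{grad}F_{W_t}(\hat{\mathbf U}_{t,k})\big)\qquad(t\ge T,\ 0\le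 k\le K-1).$$ **Lemma (Single step decay bound).** Let $r>0$. Then, for all $t\ge T$ and $0\le k\le K-1$ with $\hat{\mathbf U}_{t,k}\in\mathbb B_r(\mathbf U_t)$, $$d_2(\hat{\mathbf U}_{t,k+1},\mathbf U_t)^2\le d_2(\hat{\mathbf U}_{t,k},\mathbf U_t)^2-\rho\,\big\|\mathrm{grad}\,d_2(\hat{\mathbf U}_{t,k},\mathbf U_t)^2\big\|_F^2+\gamma_r(\delta_t),$$ where the gradient is taken with respect to the first argument, $\rho=\alpha\underline\sigma^2-2\alpha^2\overline\sigma^4$, $$\delta_t=c\,\|W_tD\|_F+\epsilon\sqrt T\,\big(c(T-1)+1\big)\ge0,\qquad D=\mathrm{diag}(T-1,T-2,\dots,0),$$ $$\gamma_r(\delta)=8\alpha r\overline\sigma(1+4\alpha\overline\sigma^2)\,\delta+\big(4\alpha r+16\alpha^2\overline\sigma^2(r+2)\big)\delta^2+32\alpha^2\overline\sigma\,\delta^3+8\alpha^2\delta^4,$$ and $\gamma_r\in\mathcal K_\infty$, i.e. $\gamma_r:[0,\infty)\to[0,\infty)$ is continuous, strictly increasing, unbounded, and $\gamma_r(0)=0$.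 -/

import Mathlib

open scoped Matrix Matrix.Norms.Frobenius

noncomputable section

namespace GrassmannTracking

/-! Throughout, `‖A‖` is the Frobenius norm when `A` is a matrix
(scoped instances of `Matrix.Norms.Frobenius`), and the Euclidean norm for `EuclideanSpace`. -/

/-- The Grassmannian `Gr(n, d)`: the subspaces of dimension `d` of `ℝⁿ`. -/
def Gr (n d : ℕ) : Type :=
  {S : Submodule ℝ (EuclideanSpace ℝ (Fin n)) // Module.finrank ℝ S = d}

/-- The matrix `P_S` of the orthogonal projection onto a subspace `S` of `ℝⁿ`. -/
def projMat {n : ℕ} (S : Submodule ℝ (EuclideanSpace ℝ (Fin n))) :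
    Matrix (Fin n) (Fin n) ℝ :=
  Matrix.toEuclideanLin.symm (S.starProjection : EuclideanSpace ℝ (Fin n) →ₗ[ℝ] _)

/-- The matrix of the orthogonal projection onto the orthogonal complement, `I - P_S`. -/
def projPerpMat {n : ℕ} (S : Submodule ℝ (EuclideanSpace ℝ (Fin n))) :
    Matrix (Fin n) (Fin n) ℝ :=
  1 - projMat S

/-- The span of the columns of a matrix. -/
def colSpan {n d : ℕ} (Y : Matrix (Fin n) (Fin d) ℝ) :
    Submodule ℝ (EuclideanSpace ℝ (Fin n)) :=
  LinearMap.range (Matrix.toEuclideanLin Y)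

/-- `Y` is an orthonormal matrix representation of the subspace `U`. -/
def IsRep {n d : ℕ} (Y : Matrix (Fin n) (Fin d) ℝ) (U : Gr n d) : Prop :=
  Yᵀ * Y = 1 ∧ colSpan Y = U.1

/-- The chordal distance `d₂(U, V) = (tr (P_U^⊥ P_V))^{1/2}`. -/
def chordalDist {n d : ℕ} (U V : Gr n d) : ℝ :=
  √(Matrix.trace (projPerpMat U.1 * projMat V.1))

/-- The metric ball of radius `r` around `U` in the chordal distance. -/
def chordalBall {n d : ℕ} (r : ℝ) (U : Gr n d) : Set (Gr n d) :=
  {V | chordalDist U V ≤ r}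

/-- `σ_i(A)`, the `i`-th largest singular value of `A`, with `i = 1, 2, …`
(Mathlib indexes singular values from zero). -/
def sigma {n m : ℕ} (i : ℕ) (A : Matrix (Fin n) (Fin m) ℝ) : ℝ :=
  (Matrix.toEuclideanLin A).singularValues (i - 1)

/-- `V` represents, with respect to the orthonormal representation `Y`, the Riemannian gradient
of `f` at the span of `Y`: `V = P^⊥ ∇f̄(Y)`, where `f̄` is an extension to all matrices of
`f` (as a function of orthonormal representations) and `∇f̄(Y)` is its Euclidean gradient
for the Frobenius inner product `⟨A, B⟩ = tr (Aᵀ B)`. -/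
def IsRiemGrad {n d : ℕ} (f : Gr n d → ℝ) (Y V : Matrix (Fin n) (Fin d) ℝ) : Prop :=
  ∃ (fbar : Matrix (Fin n) (Fin d) ℝ → ℝ) (G : Matrix (Fin n) (Fin d) ℝ),
    (∀ Q U, IsRep Q U → fbar Q = f U) ∧
    DifferentiableAt ℝ fbar Y ∧ (∀ X, fderiv ℝ fbar Y X = Matrix.trace (Gᵀ * X)) ∧
    V = (1 - Y * Yᵀ) * G

open Classical in
/-- The representation of `grad f` with respect to the orthonormal representation `Y`
(zero where `f` has no gradient). -/
def riemGrad {n d : ℕ} (f : Gr n d → ℝ) (Y : Matrix (Fin n) (Fin d) ℝ) :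
    Matrix (Fin n) (Fin d) ℝ :=
  if h : ∃ V, IsRiemGrad f Y V then h.choose else 0

/-- `V = Q₁ diag(σ) Q₂ᵀ` is a compact singular value decomposition. The columns of `Q₁` that
belong to zero singular values play no role and are left free. -/
def IsCompactSVD {n d : ℕ} (V Q₁ : Matrix (Fin n) (Fin d) ℝ) (σ : Fin d → ℝ)
    (Q₂ : Matrix (Fin d) (Fin d) ℝ) : Prop :=
  Q₂ᵀ * Q₂ = 1 ∧ (∀ i, 0 ≤ σ i) ∧
  (∀ i j, σ i ≠ 0 → σ j ≠ 0 → (Q₁ᵀ * Q₁) i j = if i = j then 1 else 0) ∧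
  V = Q₁ * Matrix.diagonal σ * Q₂ᵀ

/-- `U' = Exp_U(V)`, where the matrix `V` represents a tangent vector at `U` with respect to the
orthonormal representation `Y` of `U`:
`U'` is spanned by `[Y Q₂, Q₁] [diag (cos σ); diag (sin σ)] Q₂ᵀ` for `V = Q₁ diag(σ) Q₂ᵀ`. -/
def IsExp {n d : ℕ} (Y V : Matrix (Fin n) (Fin d) ℝ) (U' : Gr n d) : Prop :=
  ∃ (Q₁ : Matrix (Fin n) (Fin d) ℝ) (σ : Fin d → ℝ) (Q₂ : Matrix (Fin d) (Fin d) ℝ),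
    IsCompactSVD V Q₁ σ Q₂ ∧
    IsRep ((Y * Q₂ * Matrix.diagonal (fun i => Real.cos (σ i)) +
      Q₁ * Matrix.diagonal (fun i => Real.sin (σ i))) * Q₂ᵀ) U'

/-- The cost `F_W(U) = ‖P_U^⊥ W‖_F²`. -/
def cost {n d T : ℕ} (W : Matrix (Fin n) (Fin T) ℝ) (U : Gr n d) : ℝ :=
  ‖projPerpMat U.1 * W‖ ^ 2

/-- One gradient step: `U' = Exp_U(-α grad F_W(U))`, computed in some orthonormal
representation of `U`. -/
def IsGradStep {n d T : ℕ} (α : ℝ) (W : Matrix (Fin n) (Fin T) ℝ) (U U' : Gr n d) : Prop :=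
  ∃ Y : Matrix (Fin n) (Fin d) ℝ, IsRep Y U ∧ IsExp Y (-(α • riemGrad (cost W) Y)) U'

/-- The data window `W_t = [u_{t-T+1} … u_t]` (used for `t ≥ T` only). -/
def dataMat {n : ℕ} (u : ℕ → EuclideanSpace ℝ (Fin n)) (T t : ℕ) :
    Matrix (Fin n) (Fin T) ℝ :=
  Matrix.of fun i j => u (t + 1 + (j : ℕ) - T) i

/-- The noise bound
`δ_t = c ‖W_t D‖_F + ε √T (c (T - 1) + 1)` with `D = diag (T - 1, T - 2, …, 0)`. -/
def noiseBound {n : ℕ} (u : ℕ → EuclideanSpace ℝ (Fin n)) (c ε : ℝ) (T t : ℕ) : ℝ :=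
  c * ‖dataMat u T t * Matrix.diagonal (fun j : Fin T => (T : ℝ) - 1 - (j : ℕ))‖ +
    ε * √(T : ℝ) * (c * ((T : ℝ) - 1) + 1)

/-- The bias polynomial `γ_r`. -/
def gammaPoly (α σup r δ : ℝ) : ℝ :=
  8 * α * r * σup * (1 + 4 * α * σup ^ 2) * δ +
    (4 * α * r + 16 * α ^ 2 * σup ^ 2 * (r + 2)) * δ ^ 2 +
    32 * α ^ 2 * σup * δ ^ 3 + 8 * α ^ 2 * δ ^ 4

/-- The class `𝒦_∞`, for a function on `[0, ∞)` given as the restriction of `g : ℝ → ℝ`. -/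
def IsClassKInf (g : ℝ → ℝ) : Prop :=
  ContinuousOn g (Set.Ici 0) ∧ StrictMonoOn g (Set.Ici 0) ∧ (∀ x, 0 ≤ x → 0 ≤ g x) ∧
    g 0 = 0 ∧ Filter.Tendsto g Filter.atTop Filter.atTop

end GrassmannTracking

end

noncomputable section

namespace GrassmannTracking

/-! Let `P` and `Q` be the projections onto the tracked subspace and onto the current iterate, and
let `L = (1 - P) Q P`. Split the data as `W = A + E` with `A = P W`, so that `W Wᵀ = A Aᵀ + N`,
where `N` collects the noise and `‖N‖ ≤ ν = 2 σup δ + δ²` as soon as `‖E‖ ≤ δ`. The step is `V = 2α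
(1 - Q)(A Aᵀ + N) Y`.

An entrywise inequality between trigonometric functions and a quadratic polynomial gives a
second-order bound along the geodesic (`chordalDist_sq_exp_le`): the squared distance grows by at
most `2⟨(1 - P) Y, (1 - P) V⟩ + ‖(1 - P) Y Vᵀ‖² + ‖(1 - P) V‖²`. Since `(1 - P)(1 - Q) A = -L A`,
the inner product is at most `2α (-‖L A‖² + ‖L‖ ν)`, and both norms are at most `2α (‖L A Aᵀ‖ + ν)`.

The singular value bounds turn these into `‖L A‖ ≥ σlow ‖L‖` and `‖L A Aᵀ‖ ≤ σup² ‖L‖`. The gradient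
of the squared distance has squared norm exactly `4 ‖L‖²`, so the terms in `‖L‖²` produce `ρ`,
whatever its sign, and the terms containing `ν` produce `γ_r` because `‖L‖ ≤ r`.

Finally, a data column of age `k` leaves the present subspace only through its noise and through a
drift of at most `c k`; summing over columns gives `‖E‖ ≤ δ_t`. -/

/-! ### Frobenius norm and orthogonal projections -/

theorem frobenius_sq {n m : ℕ} (A : Matrix (Fin n) (Fin m) ℝ) :
    ‖A‖ ^ 2 = ∑ i, ∑ j, A i j ^ 2 := by
  rw [Matrix.frobenius_norm_def, ← Real.sqrt_eq_rpow, Real.sq_sqrt (by positivity)]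
  simp

theorem trace_transpose_mul_apply {n m : ℕ} (A B : Matrix (Fin n) (Fin m) ℝ) :
    (Aᵀ * B).trace = ∑ i, ∑ j, A i j * B i j := by
  rw [Finset.sum_comm]
  simp [Matrix.trace, Matrix.mul_apply]

theorem frobenius_sq_eq_trace {n m : ℕ} (A : Matrix (Fin n) (Fin m) ℝ) :
    ‖A‖ ^ 2 = (Aᵀ * A).trace := by
  rw [frobenius_sq, trace_transpose_mul_apply]
  simp only [sq]

theorem frobenius_sq_eq_trace' {n m : ℕ} (A : Matrix (Fin n) (Fin m) ℝ) :
    ‖A‖ ^ 2 = (A * Aᵀ).trace := by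
  rw [frobenius_sq_eq_trace, Matrix.trace_mul_comm]

theorem trace_transpose_mul_le {n m : ℕ} (A B : Matrix (Fin n) (Fin m) ℝ) :
    (Aᵀ * B).trace ≤ ‖A‖ * ‖B‖ := by
  refine le_of_sq_le_sq ?_ (by positivity) 
  rw [mul_pow, frobenius_sq, frobenius_sq, trace_transpose_mul_apply]
  simp only [← Finset.sum_product']
  exact Finset.sum_mul_sq_le_sq_mul_sq _ _ _

/-- The matrix of an orthogonal projection. -/
structure IsOrthProj {n : ℕ} (P : Matrix (Fin n) (Fin n) ℝ) : Prop where
  transpose : Pᵀ = P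
  idem : P * P = P

theorem IsOrthProj.compl {n : ℕ} {P : Matrix (Fin n) (Fin n) ℝ} (h : IsOrthProj P) :
    IsOrthProj (1 - P) :=
  ⟨by simp [h.transpose], by simp [mul_sub, sub_mul, h.idem]⟩

theorem IsOrthProj.norm_sq_mul {n m : ℕ} {P : Matrix (Fin n) (Fin n) ℝ} (h : IsOrthProj P)
    (A : Matrix (Fin n) (Fin m) ℝ) : ‖P * A‖ ^ 2 = (Aᵀ * P * A).trace := by
  rw [frobenius_sq_eq_trace, Matrix.transpose_mul, h.transpose]
  congr 1
  calc Aᵀ * P * (P * A) = Aᵀ * (P * P) * A := by simp only [Matrix.mul_assoc]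
    _ = _ := by rw [h.idem]

theorem IsOrthProj.norm_sq_add {n m : ℕ} {P : Matrix (Fin n) (Fin n) ℝ} (h : IsOrthProj P)
    (A : Matrix (Fin n) (Fin m) ℝ) : ‖P * A‖ ^ 2 + ‖(1 - P) * A‖ ^ 2 = ‖A‖ ^ 2 := by
  rw [h.norm_sq_mul, h.compl.norm_sq_mul, frobenius_sq_eq_trace, ← Matrix.trace_add]
  simp [Matrix.mul_sub, Matrix.sub_mul]

theorem IsOrthProj.norm_mul_le {n m : ℕ} {P : Matrix (Fin n) (Fin n) ℝ} (h : IsOrthProj P)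
    (A : Matrix (Fin n) (Fin m) ℝ) : ‖P * A‖ ≤ ‖A‖ := by
  refine le_of_sq_le_sq ?_ (norm_nonneg _)
  nlinarith [h.norm_sq_add A, sq_nonneg ‖(1 - P) * A‖]

theorem IsOrthProj.norm_mul_le' {n m : ℕ} {P : Matrix (Fin n) (Fin n) ℝ} (h : IsOrthProj P)
    (A : Matrix (Fin m) (Fin n) ℝ) : ‖A * P‖ ≤ ‖A‖ := by
  rw [← Matrix.frobenius_norm_transpose, ← Matrix.frobenius_norm_transpose A,
    Matrix.transpose_mul, h.transpose]
  exact h.norm_mul_le _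

theorem isOrthProj_mul_transpose {n d : ℕ} {Y : Matrix (Fin n) (Fin d) ℝ} (h : Yᵀ * Y = 1) :
    IsOrthProj (Y * Yᵀ) :=
  ⟨by simp, by rw [Matrix.mul_assoc, ← Matrix.mul_assoc Yᵀ, h, Matrix.one_mul]⟩

theorem norm_mul_of_orthonormal {n d m : ℕ} {Y : Matrix (Fin n) (Fin d) ℝ} (h : Yᵀ * Y = 1)
    (A : Matrix (Fin d) (Fin m) ℝ) : ‖Y * A‖ = ‖A‖ := by
  refine (sq_eq_sq₀ (norm_nonneg _) (norm_nonneg _)).1 ?_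
  rw [frobenius_sq_eq_trace, frobenius_sq_eq_trace, Matrix.transpose_mul, Matrix.mul_assoc,
    ← Matrix.mul_assoc Yᵀ, h, Matrix.one_mul]

theorem norm_mul_transpose_of_orthonormal {n d m : ℕ} {Y : Matrix (Fin n) (Fin d) ℝ}
    (h : Yᵀ * Y = 1) (A : Matrix (Fin m) (Fin d) ℝ) : ‖A * Yᵀ‖ = ‖A‖ := by
  rw [← Matrix.frobenius_norm_transpose, ← Matrix.frobenius_norm_transpose A,
    Matrix.transpose_mul, Matrix.transpose_transpose, norm_mul_of_orthonormal h]

theorem norm_mul_le_of_orthonormal {n d m : ℕ} {Y : Matrix (Fin n) (Fin d) ℝ}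
    (h : Yᵀ * Y = 1) (A : Matrix (Fin m) (Fin n) ℝ) : ‖A * Y‖ ≤ ‖A‖ := by
  rw [← norm_mul_transpose_of_orthonormal h, Matrix.mul_assoc]
  exact (isOrthProj_mul_transpose h).norm_mul_le' A

/-! ### Projection matrices of subspaces -/

theorem projMat_eq_of_isRep {n d : ℕ} {Y : Matrix (Fin n) (Fin d) ℝ} {U : Gr n d}
    (h : IsRep Y U) : projMat U.1 = Y * Yᵀ := by
  rw [projMat, LinearEquiv.symm_apply_eq]
  ext1 v
  refine Submodule.eq_starProjection_of_mem_of_inner_eq_zero (K := U.1) ?_ ?_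
  · rw [← h.2]
    refine ⟨Matrix.toEuclideanLin Yᵀ v, ?_⟩
    simp [Matrix.toLpLin_apply, Matrix.mulVec_mulVec]
  · rw [← h.2]
    rintro _ ⟨w, rfl⟩
    have : Matrix.toEuclideanLin Yᵀ (v - Matrix.toEuclideanLin (Y * Yᵀ) v) = 0 := by
      simp [Matrix.toLpLin_apply, Matrix.mulVec_sub, Matrix.mulVec_mulVec, ← Matrix.mul_assoc,
        h.1]
    have h2 : Matrix.toEuclideanLin Y = LinearMap.adjoint (Matrix.toEuclideanLin Yᵀ) := by
      rw [← Matrix.toEuclideanLin_conjTranspose_eq_adjoint]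
      simp
    rw [h2, LinearMap.adjoint_inner_right, this, inner_zero_left]

theorem transpose_mul_self_of_orthonormal {n d : ℕ} {b : Fin d → EuclideanSpace ℝ (Fin n)}
    (hb : Orthonormal ℝ b) :
    (Matrix.of fun i j => b j i)ᵀ * (Matrix.of fun i j => b j i) = 1 := by
  ext i j
  have := orthonormal_iff_ite.1 hb i j
  rw [Matrix.one_apply, ← this]
  simp [Matrix.mul_apply, PiLp.inner_apply, mul_comm]

theorem exists_isRep {n d : ℕ} (U : Gr n d) : ∃ Z, IsRep Z U := by
  have hU : Module.finrank ℝ U.1 = d := U.2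
  let b := (stdOrthonormalBasis ℝ U.1).reindex (finCongr hU)
  refine ⟨Matrix.of fun i j => (b j : EuclideanSpace ℝ (Fin n)) i, ?_, ?_⟩
  · exact transpose_mul_self_of_orthonormal
      (b.orthonormal.comp_linearIsometry U.1.subtypeₗᵢ)
  · refine le_antisymm ?_ ?_
    · rintro _ ⟨w, rfl⟩
      have : Matrix.toEuclideanLin (Matrix.of fun i j => (b j : EuclideanSpace ℝ (Fin n)) i) w
          = ∑ j, w j • (b j : EuclideanSpace ℝ (Fin n)) := by
        ext i
        simp [Matrix.toLpLin_apply, Matrix.mulVec, dotProduct, mul_comm]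
      rw [this]
      exact Submodule.sum_mem _ fun j _ => Submodule.smul_mem _ _ (b j).2
    · intro v hv
      refine ⟨WithLp.toLp 2 fun j => b.repr ⟨v, hv⟩ j, ?_⟩
      have := congrArg (Subtype.val) (b.sum_repr ⟨v, hv⟩)
      ext i
      have h2 := congrArg (fun x : EuclideanSpace ℝ (Fin n) => x i) this
      simp only [Submodule.coe_sum, Submodule.coe_smul] at h2
      rw [← h2]
      simp [Matrix.toLpLin_apply, Matrix.mulVec, dotProduct, mul_comm]

theorem isOrthProj_projMat {n d : ℕ} (U : Gr n d) : IsOrthProj (projMat U.1) := by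
  obtain ⟨Z, hZ⟩ := exists_isRep U
  rw [projMat_eq_of_isRep hZ]
  exact isOrthProj_mul_transpose hZ.1

theorem trace_projMat {n d : ℕ} (U : Gr n d) : (projMat U.1).trace = d := by
  obtain ⟨Z, hZ⟩ := exists_isRep U
  rw [projMat_eq_of_isRep hZ, Matrix.trace_mul_comm, hZ.1]
  simp

theorem toEuclideanLin_projMat {n d : ℕ} (U : Gr n d) (v : EuclideanSpace ℝ (Fin n)) :
    Matrix.toEuclideanLin (projMat U.1) v = U.1.starProjection v := by
  simp [projMat]

/-! ### The chordal distance -/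

theorem trace_projPerpMat_mul {n d : ℕ} (U V : Gr n d) :
    (projPerpMat U.1 * projMat V.1).trace = d - (projMat U.1 * projMat V.1).trace := by
  simp [projPerpMat, Matrix.sub_mul, trace_projMat]

theorem norm_sq_projPerpMat_mul {n d : ℕ} (U V : Gr n d) :
    ‖projPerpMat U.1 * projMat V.1‖ ^ 2 = (projPerpMat U.1 * projMat V.1).trace := by
  rw [projPerpMat, (isOrthProj_projMat U).compl.norm_sq_mul, (isOrthProj_projMat V).transpose,
    Matrix.mul_assoc, Matrix.trace_mul_comm, Matrix.mul_assoc, (isOrthProj_projMat V).idem]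

theorem chordalDist_eq_norm {n d : ℕ} (U V : Gr n d) :
    chordalDist U V = ‖projPerpMat U.1 * projMat V.1‖ := by
  rw [chordalDist, ← norm_sq_projPerpMat_mul, Real.sqrt_sq (norm_nonneg _)]

theorem chordalDist_sq {n d : ℕ} (U V : Gr n d) :
    chordalDist U V ^ 2 = (projPerpMat U.1 * projMat V.1).trace := by
  rw [chordalDist_eq_norm, norm_sq_projPerpMat_mul]

theorem chordalDist_nonneg {n d : ℕ} (U V : Gr n d) : 0 ≤ chordalDist U V :=
  Real.sqrt_nonneg _

theorem chordalDist_comm {n d : ℕ} (U V : Gr n d) : chordalDist U V = chordalDist V U := by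
  rw [chordalDist, chordalDist, trace_projPerpMat_mul, trace_projPerpMat_mul,
    Matrix.trace_mul_comm]

/-- Up to the factor `√2`, the chordal distance is the Frobenius distance of the projections; the
triangle inequality is inherited from it. -/
theorem chordalDist_sq_eq_norm_sub {n d : ℕ} (U V : Gr n d) :
    2 * chordalDist U V ^ 2 = ‖projMat U.1 - projMat V.1‖ ^ 2 := by
  rw [chordalDist_sq, trace_projPerpMat_mul, frobenius_sq_eq_trace, Matrix.transpose_sub,
    (isOrthProj_projMat V).transpose, (isOrthProj_projMat U).transpose]
  simp only [sub_mul, mul_sub, (isOrthProj_projMat V).idem, (isOrthProj_projMat U).idem,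
    Matrix.trace_sub, trace_projMat, Matrix.trace_mul_comm (projMat V.1)]
  ring

theorem chordalDist_eq_norm_sub {n d : ℕ} (U V : Gr n d) :
    √2 * chordalDist U V = ‖projMat U.1 - projMat V.1‖ := by
  refine (sq_eq_sq₀ (mul_nonneg (by positivity) (chordalDist_nonneg U V)) (norm_nonneg _)).1 ?_
  rw [← chordalDist_sq_eq_norm_sub, mul_pow, Real.sq_sqrt (by norm_num)]

theorem chordalDist_triangle {n d : ℕ} (U V W : Gr n d) :
    chordalDist U W ≤ chordalDist U V + chordalDist V W := by
  refine le_of_mul_le_mul_left ?_ (show (0 : ℝ) < √2 by positivity)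
  rw [mul_add, chordalDist_eq_norm_sub, chordalDist_eq_norm_sub, chordalDist_eq_norm_sub]
  exact norm_sub_le_norm_sub_add_norm_sub _ _ _

theorem chordalDist_self {n d : ℕ} (U : Gr n d) : chordalDist U U = 0 := by
  rw [chordalDist, trace_projPerpMat_mul, (isOrthProj_projMat U).idem, trace_projMat]
  simp

theorem chordalDist_sq_eq_of_isRep {n d : ℕ} {Y : Matrix (Fin n) (Fin d) ℝ} {X : Gr n d}
    (hY : IsRep Y X) (U : Gr n d) : chordalDist X U ^ 2 = ‖projPerpMat U.1 * Y‖ ^ 2 := by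
  rw [chordalDist_comm, chordalDist_eq_norm, projMat_eq_of_isRep hY, ← Matrix.mul_assoc,
    norm_mul_transpose_of_orthonormal hY.1]

/-! ### Riemannian gradients: independence of the extension, and explicit formulas -/

theorem exists_isRep_of_orthonormal {n d : ℕ} {Q : Matrix (Fin n) (Fin d) ℝ} (hQ : Qᵀ * Q = 1) :
    ∃ U : Gr n d, IsRep Q U := by
  have hinj : Function.Injective (Matrix.toEuclideanLin Q) := by
    refine Function.LeftInverse.injective (g := Matrix.toEuclideanLin Qᵀ) fun v => ?_
    simp [Matrix.toLpLin_apply, Matrix.mulVec_mulVec, hQ]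
  exact ⟨⟨colSpan Q, by rw [colSpan, LinearMap.finrank_range_of_inj hinj]; simp⟩, hQ, rfl⟩

theorem exp_smul_skew_orthogonal {n : ℕ} {K : Matrix (Fin n) (Fin n) ℝ} (hK : Kᵀ = -K) (t : ℝ) :
    (NormedSpace.exp (t • K))ᵀ * NormedSpace.exp (t • K) = 1 := by
  rw [← Matrix.exp_transpose, Matrix.transpose_smul, hK, smul_neg, Matrix.exp_neg]
  exact Matrix.nonsing_inv_mul _
    ((Matrix.isUnit_iff_isUnit_det _).1 (Matrix.isUnit_exp _))

theorem hasDerivAt_exp_smul_mul {n d : ℕ} (K : Matrix (Fin n) (Fin n) ℝ)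
    (Y : Matrix (Fin n) (Fin d) ℝ) :
    HasDerivAt (fun t : ℝ => NormedSpace.exp (t • K) * Y) (K * Y) 0 := by
  have h := hasDerivAt_exp_smul_const (𝕂 := ℝ) K (0 : ℝ)
  simp only [zero_smul, NormedSpace.exp_zero, one_mul] at h
  exact (LinearMap.toContinuousLinearMap
    (mulRightLinearMap (Fin n) ℝ Y)).hasFDerivAt.comp_hasDerivAt 0 h

/-- Along horizontal directions, differentiable extensions of the same function have the same
derivative. -/
theorem trace_eq_of_extensions {n d : ℕ} {f : Gr n d → ℝ} {Y : Matrix (Fin n) (Fin d) ℝ}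
    (hY : Yᵀ * Y = 1) {f₁ f₂ : Matrix (Fin n) (Fin d) ℝ → ℝ}
    (h₁ : ∀ Q U, IsRep Q U → f₁ Q = f U) (h₂ : ∀ Q U, IsRep Q U → f₂ Q = f U)
    (d₁ : DifferentiableAt ℝ f₁ Y) (d₂ : DifferentiableAt ℝ f₂ Y)
    {X : Matrix (Fin n) (Fin d) ℝ} (hX : Yᵀ * X = 0) :
    fderiv ℝ f₁ Y X = fderiv ℝ f₂ Y X := by
  have hX' : Xᵀ * Y = 0 := by
    rw [← Matrix.transpose_transpose Y, ← Matrix.transpose_mul, hX, Matrix.transpose_zero]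
  -- A skew generator with `K Y = X`: the curve `exp (t K) Y` has velocity `X` at `Y` and stays
  -- among orthonormal matrices, where both extensions equal `f`.
  set K := X * Yᵀ - Y * Xᵀ with hKdef
  have hK : Kᵀ = -K := by simp [hKdef]
  have hKY : K * Y = X := by
    simp [hKdef, Matrix.sub_mul, Matrix.mul_assoc, hY, hX']
  have hγ := hasDerivAt_exp_smul_mul K Y
  rw [hKY] at hγ
  have h0 : NormedSpace.exp ((0 : ℝ) • K) * Y = Y := by simp
  have e₁ : HasDerivAt (fun t : ℝ => f₁ (NormedSpace.exp (t • K) * Y)) (fderiv ℝ f₁ Y X) 0 := by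
    refine HasFDerivAt.comp_hasDerivAt 0 ?_ hγ
    rw [h0]
    exact d₁.hasFDerivAt
  have e₂ : HasDerivAt (fun t : ℝ => f₂ (NormedSpace.exp (t • K) * Y)) (fderiv ℝ f₂ Y X) 0 := by
    refine HasFDerivAt.comp_hasDerivAt 0 ?_ hγ
    rw [h0]
    exact d₂.hasFDerivAt
  have heq : (fun t : ℝ => f₁ (NormedSpace.exp (t • K) * Y)) =
      fun t : ℝ => f₂ (NormedSpace.exp (t • K) * Y) := by
    funext t
    obtain ⟨U, hU⟩ := exists_isRep_of_orthonormal
      (Q := NormedSpace.exp (t • K) * Y) (by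
        rw [Matrix.transpose_mul, Matrix.mul_assoc, ← Matrix.mul_assoc _ _ Y,
          exp_smul_skew_orthogonal hK, Matrix.one_mul, hY])
    rw [h₁ _ U hU, h₂ _ U hU]
  rw [heq] at e₁
  exact e₁.unique e₂

/-- The difference of the two candidates is itself a horizontal direction. Testing the equal
derivatives on it shows that its squared norm vanishes, so the choice made in `riemGrad` is
immaterial. -/
theorem IsRiemGrad.unique {n d : ℕ} {f : Gr n d → ℝ} {Y V₁ V₂ : Matrix (Fin n) (Fin d) ℝ}
    (hY : Yᵀ * Y = 1) (h₁ : IsRiemGrad f Y V₁) (h₂ : IsRiemGrad f Y V₂) : V₁ = V₂ := by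
  obtain ⟨f₁, G₁, hf₁, hd₁, hg₁, rfl⟩ := h₁
  obtain ⟨f₂, G₂, hf₂, hd₂, hg₂, rfl⟩ := h₂
  have hP := (isOrthProj_mul_transpose hY).compl
  have hX : Yᵀ * ((1 - Y * Yᵀ) * (G₁ - G₂)) = 0 := by
    rw [← Matrix.mul_assoc, Matrix.mul_sub Yᵀ, ← Matrix.mul_assoc Yᵀ, hY]
    simp
  have key := trace_eq_of_extensions hY hf₁ hf₂ hd₁ hd₂ hX
  rw [hg₁, hg₂, ← sub_eq_zero, ← Matrix.trace_sub, ← Matrix.sub_mul, ← Matrix.transpose_sub,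
    ← Matrix.mul_assoc, ← hP.norm_sq_mul] at key
  rw [← sub_eq_zero, ← Matrix.mul_sub]
  simpa using key

theorem riemGrad_eq {n d : ℕ} {f : Gr n d → ℝ} {Y V : Matrix (Fin n) (Fin d) ℝ}
    (hY : Yᵀ * Y = 1) (h : IsRiemGrad f Y V) : riemGrad f Y = V := by
  have hex : ∃ V, IsRiemGrad f Y V := ⟨V, h⟩
  rw [riemGrad, dif_pos hex]
  exact hex.choose_spec.unique hY h

theorem hasFDerivAt_quadratic {n d : ℕ} (A : Matrix (Fin n) (Fin n) ℝ) (hA : Aᵀ = A)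
    (Y : Matrix (Fin n) (Fin d) ℝ) :
    ∃ L : Matrix (Fin n) (Fin d) ℝ →L[ℝ] ℝ,
      HasFDerivAt (fun Q : Matrix (Fin n) (Fin d) ℝ => (Qᵀ * A * Q).trace) L Y ∧
        ∀ X, L X = 2 * ((A * Y)ᵀ * X).trace := by
  let B : Matrix (Fin n) (Fin d) ℝ →ₗ[ℝ] Matrix (Fin n) (Fin d) ℝ →ₗ[ℝ] ℝ :=
    LinearMap.mk₂ ℝ (fun Q R => (Qᵀ * A * R).trace)
      (by intros; simp [Matrix.add_mul]) (by intros; simp)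
      (by intros; simp [Matrix.mul_add]) (by intros; simp)
  let Bc := LinearMap.toContinuousLinearMap
    ((LinearMap.toContinuousLinearMap : (Matrix (Fin n) (Fin d) ℝ →ₗ[ℝ] ℝ) ≃ₗ[ℝ] _).toLinearMap ∘ₗ B)
  have h := Bc.hasFDerivAt_of_bilinear (hasFDerivAt_id Y) (hasFDerivAt_id Y)
  refine ⟨_, h, fun X => ?_⟩
  have e1 : (Yᵀ * A * X).trace = ((A * Y)ᵀ * X).trace := by rw [Matrix.transpose_mul, hA]
  have e2 : (Xᵀ * A * Y).trace = ((A * Y)ᵀ * X).trace := by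
    rw [← Matrix.trace_transpose, Matrix.transpose_mul, Matrix.transpose_mul,
      Matrix.transpose_transpose, hA, Matrix.transpose_mul, hA, Matrix.mul_assoc]
  change (Yᵀ * A * X).trace + (Xᵀ * A * Y).trace = _
  rw [e1, e2]
  ring

theorem riemGrad_trace_projPerpMat {n d : ℕ} (A : Matrix (Fin n) (Fin n) ℝ) (hA : Aᵀ = A)
    {Y : Matrix (Fin n) (Fin d) ℝ} {U : Gr n d} (hY : IsRep Y U) :
    riemGrad (fun X => (projPerpMat X.1 * A).trace) Y =
      (1 - projMat U.1) * ((-2 : ℝ) • (A * Y)) := by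
  refine riemGrad_eq hY.1 ?_
  obtain ⟨L, hL, hLX⟩ := hasFDerivAt_quadratic A hA Y
  have hd := hL.const_sub A.trace
  -- On orthonormal `Q` the function is `tr A - tr (Qᵀ A Q)`, and this quadratic polynomial makes
  -- sense for every matrix.
  refine ⟨fun Q => A.trace - (Qᵀ * A * Q).trace, (-2 : ℝ) • (A * Y), ?_, hd.differentiableAt,
    fun X => ?_, by rw [projMat_eq_of_isRep hY]⟩
  · intro Q X hQ
    simp only [projPerpMat]
    rw [projMat_eq_of_isRep hQ, Matrix.sub_mul, Matrix.trace_sub, Matrix.one_mul,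
      Matrix.mul_assoc, Matrix.trace_mul_comm Qᵀ, Matrix.mul_assoc, Matrix.trace_mul_comm A]
  · refine (DFunLike.congr_fun hd.fderiv X).trans ?_
    change -(L X) = _
    rw [hLX]
    simp

theorem riemGrad_cost {n d T : ℕ} (W : Matrix (Fin n) (Fin T) ℝ)
    {Y : Matrix (Fin n) (Fin d) ℝ} {U : Gr n d} (hY : IsRep Y U) :
    riemGrad (cost W) Y = (1 - projMat U.1) * ((-2 : ℝ) • (W * Wᵀ * Y)) := by
  rw [← riemGrad_trace_projPerpMat (W * Wᵀ) (by simp) hY]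
  congr 1
  funext X
  rw [cost, projPerpMat, (isOrthProj_projMat X).compl.norm_sq_mul, Matrix.mul_assoc,
    Matrix.trace_mul_comm, Matrix.mul_assoc]

theorem riemGrad_chordalDist_sq {n d : ℕ} (U : Gr n d)
    {Y : Matrix (Fin n) (Fin d) ℝ} {X : Gr n d} (hY : IsRep Y X) :
    riemGrad (fun X => chordalDist X U ^ 2) Y =
      (1 - projMat X.1) * ((-2 : ℝ) • (projMat U.1 * Y)) := by
  rw [← riemGrad_trace_projPerpMat _ (isOrthProj_projMat U).transpose hY]
  simp only [chordalDist_sq]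

/-! ### Singular values -/

/-- The right singular vectors of a matrix, as the columns of an orthogonal matrix. -/
theorem exists_gram_diagonalization {n T : ℕ} (A : Matrix (Fin n) (Fin T) ℝ) :
    ∃ F : Matrix (Fin T) (Fin T) ℝ, Fᵀ * F = 1 ∧
      Aᵀ * A = F * Matrix.diagonal (fun j : Fin T => sigma (j + 1) A ^ 2) * Fᵀ := by
  obtain ⟨S, hS⟩ : ∃ S, S = Matrix.toEuclideanLin A := ⟨_, rfl⟩
  have hn : Module.finrank ℝ (EuclideanSpace ℝ (Fin T)) = T := by simp
  obtain ⟨b, hb⟩ : ∃ b : OrthonormalBasis (Fin T) ℝ (EuclideanSpace ℝ (Fin T)),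
      ∀ j : Fin T, LinearMap.adjoint S (S (b j)) = (S.singularValues j ^ 2) • b j :=
    ⟨S.isSymmetric_adjoint_comp_self.eigenvectorBasis hn, fun j => by
      rw [S.sq_singularValues_fin hn j]
      exact S.isSymmetric_adjoint_comp_self.apply_eigenvectorBasis hn j⟩
  let F : Matrix (Fin T) (Fin T) ℝ := Matrix.of fun i j => b j i
  have hF : Fᵀ * F = 1 := transpose_mul_self_of_orthonormal b.orthonormal
  have hF' : F * Fᵀ = 1 := mul_eq_one_comm.1 hF
  refine ⟨F, hF, ?_⟩
  have hAF : Aᵀ * A * F = F * Matrix.diagonal (fun j : Fin T => sigma (j + 1) A ^ 2) := by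
    ext i j
    have h1 := hb j
    rw [hS, ← Matrix.toEuclideanLin_conjTranspose_eq_adjoint] at h1
    have h2 : ((Aᵀ * A) *ᵥ (b j).ofLp) i =
        (Matrix.toEuclideanLin A).singularValues j ^ 2 * b j i := by
      have h3 := congrArg (fun x : EuclideanSpace ℝ (Fin T) => x i) h1
      simpa [Matrix.toLpLin_apply, Matrix.mulVec_mulVec] using h3
    rw [Matrix.mul_diagonal, mul_comm]
    exact h2
  rw [← hAF, Matrix.mul_assoc, hF', Matrix.mul_one]

theorem sigma_nonneg {n m : ℕ} (i : ℕ) (A : Matrix (Fin n) (Fin m) ℝ) : 0 ≤ sigma i A :=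
  LinearMap.singularValues_nonneg _ _

theorem sigma_antitone {n m : ℕ} {i j : ℕ} (h : i ≤ j) (A : Matrix (Fin n) (Fin m) ℝ) :
    sigma j A ≤ sigma i A :=
  LinearMap.singularValues_antitone _ (Nat.sub_le_sub_right h 1)

theorem norm_mul_le_sigma_one {n m k : ℕ} (A : Matrix (Fin n) (Fin m) ℝ)
    (X : Matrix (Fin m) (Fin k) ℝ) : ‖A * X‖ ≤ sigma 1 A * ‖X‖ := by
  obtain ⟨F, hF, hA⟩ := exists_gram_diagonalization A
  refine le_of_sq_le_sq ?_ (mul_nonneg (sigma_nonneg _ _) (norm_nonneg _))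
  have hF' : (Fᵀ)ᵀ * Fᵀ = 1 := by simpa using mul_eq_one_comm.1 hF
  rw [mul_pow, ← norm_mul_of_orthonormal hF' X, frobenius_sq_eq_trace, frobenius_sq]
  have : (A * X)ᵀ * (A * X) =
      (Fᵀ * X)ᵀ * (Matrix.diagonal (fun j : Fin m => sigma (j + 1) A ^ 2) * (Fᵀ * X)) := by
    calc (A * X)ᵀ * (A * X) = Xᵀ * (Aᵀ * A) * X := by
          simp only [Matrix.transpose_mul, Matrix.mul_assoc]
      _ = _ := by
          rw [hA]; simp only [Matrix.transpose_mul, Matrix.transpose_transpose, Matrix.mul_assoc]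
  rw [this, trace_transpose_mul_apply, Finset.mul_sum]
  refine Finset.sum_le_sum fun i _ => ?_
  rw [Finset.mul_sum]
  refine Finset.sum_le_sum fun j _ => ?_
  rw [Matrix.diagonal_mul]
  have h1 : sigma (i + 1) A ^ 2 ≤ sigma 1 A ^ 2 :=
    pow_le_pow_left₀ (sigma_nonneg _ _) (sigma_antitone (by omega) A) 2
  nlinarith [mul_le_mul_of_nonneg_right h1 (sq_nonneg ((Fᵀ * X) i j))]

theorem norm_mul_transpose_le_sigma_one {n m k : ℕ} (A : Matrix (Fin n) (Fin m) ℝ)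
    (X : Matrix (Fin k) (Fin m) ℝ) : ‖X * Aᵀ‖ ≤ sigma 1 A * ‖X‖ := by
  rw [← Matrix.frobenius_norm_transpose, ← Matrix.frobenius_norm_transpose X,
    Matrix.transpose_mul, Matrix.transpose_transpose]
  exact norm_mul_le_sigma_one A _

/-- By duality from multiplication on the other side: `‖X A‖² = ⟨Xᵀ, A (X A)ᵀ⟩`. This avoids
comparing the singular values of `A` and `Aᵀ`. -/
theorem norm_mul_le_sigma_one' {n m k : ℕ} (A : Matrix (Fin n) (Fin m) ℝ)
    (X : Matrix (Fin k) (Fin n) ℝ) : ‖X * A‖ ≤ sigma 1 A * ‖X‖ := by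
  rcases eq_or_ne ‖X * A‖ 0 with h | h
  · rw [h]
    exact mul_nonneg (sigma_nonneg _ _) (norm_nonneg _)
  refine le_of_mul_le_mul_left ?_ (lt_of_le_of_ne (norm_nonneg (X * A)) h.symm)
  calc ‖X * A‖ * ‖X * A‖ = (X * A * (X * A)ᵀ).trace := by rw [← sq, frobenius_sq_eq_trace']
    _ = (Xᵀᵀ * (A * (X * A)ᵀ)).trace := by rw [Matrix.transpose_transpose, Matrix.mul_assoc]
    _ ≤ ‖Xᵀ‖ * ‖A * (X * A)ᵀ‖ := trace_transpose_mul_le _ _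
    _ ≤ ‖X‖ * (sigma 1 A * ‖X * A‖) := by
        rw [Matrix.frobenius_norm_transpose]
        gcongr
        exact (norm_mul_le_sigma_one _ _).trans_eq (by rw [Matrix.frobenius_norm_transpose])
    _ = _ := by ring

/-- If the columns of `A` lie in the `d`-dimensional subspace `U`, then `σ_d(A)` bounds `Aᵀ` from
below on `U`. -/
theorem sigma_mul_norm_mul_projMat_le {n d m k : ℕ} (hm : d ≤ m) {U : Gr n d}
    {A : Matrix (Fin n) (Fin m) ℝ} (hA : projMat U.1 * A = A) (hpos : 0 < sigma d A)
    (X : Matrix (Fin k) (Fin n) ℝ) :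
    sigma d A * ‖X * projMat U.1‖ ≤ ‖X * A‖ := by
  obtain ⟨F, hF, hAF⟩ := exists_gram_diagonalization A
  let F₁ : Matrix (Fin m) (Fin d) ℝ := F.submatrix id (Fin.castLE hm)
  let s : Fin d → ℝ := fun j => sigma (j + 1) A
  have hs : ∀ j, sigma d A ≤ s j := fun j => sigma_antitone (by omega) A
  have hs0 : ∀ j, 0 < s j := fun j => hpos.trans_le (hs j)
  have hF₁ : F₁ᵀ * F₁ = 1 := by
    ext i j
    have := congrFun (congrFun hF (Fin.castLE hm i)) (Fin.castLE hm j)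
    rw [Matrix.mul_apply, Matrix.one_apply] at this
    rw [Matrix.mul_apply, Matrix.one_apply]
    simpa [F₁] using this
  have hD : F₁ᵀ * (Aᵀ * A) * F₁ = Matrix.diagonal (fun j => s j ^ 2) := by
    have : Fᵀ * (Aᵀ * A) * F = Matrix.diagonal (fun j : Fin m => sigma (j + 1) A ^ 2) := by
      rw [hAF]
      calc _ = (Fᵀ * F) * Matrix.diagonal (fun j : Fin m => sigma (j + 1) A ^ 2) * (Fᵀ * F) := by simp only [Matrix.mul_assoc]
        _ = _ := by rw [hF, Matrix.one_mul, Matrix.mul_one]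
    ext i j
    have h2 := congrFun (congrFun this (Fin.castLE hm i)) (Fin.castLE hm j)
    rw [Matrix.diagonal_apply] at h2 ⊢
    simpa [F₁, s, Matrix.mul_apply] using h2
  -- The first `d` left singular vectors of `A`; they are orthonormal and lie in `U`, hence form a
  -- basis of `U`.
  let Z : Matrix (Fin n) (Fin d) ℝ := A * F₁ * Matrix.diagonal (fun j => (s j)⁻¹)
  have hZs : Z * Matrix.diagonal s = A * F₁ := by
    simp only [Z]
    rw [Matrix.mul_assoc, Matrix.diagonal_mul_diagonal]
    have : (fun i => (s i)⁻¹ * s i) = fun _ => 1 :=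
      funext fun i => inv_mul_cancel₀ (hs0 i).ne'
    rw [this, Matrix.diagonal_one, Matrix.mul_one]
  have hZ : Zᵀ * Z = 1 := by
    calc Zᵀ * Z = Matrix.diagonal (fun j => (s j)⁻¹) * (F₁ᵀ * (Aᵀ * A) * F₁) *
          Matrix.diagonal (fun j => (s j)⁻¹) := by
          simp only [Z, Matrix.transpose_mul, Matrix.diagonal_transpose, Matrix.mul_assoc]
      _ = _ := by
          rw [hD, Matrix.diagonal_mul_diagonal, Matrix.diagonal_mul_diagonal,
            ← Matrix.diagonal_one]
          congr 1
          funext i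
          have := (hs0 i).ne'
          field_simp
  have hrep : IsRep Z U := by
    refine ⟨hZ, ?_⟩
    obtain ⟨U', hU'⟩ := exists_isRep_of_orthonormal hZ
    have hPZ : projMat U.1 * Z = Z := by
      simp only [Z]
      rw [← Matrix.mul_assoc, ← Matrix.mul_assoc, hA]
    refine Submodule.eq_of_le_of_finrank_eq ?_ (by rw [hU'.2, U'.2, U.2])
    rintro _ ⟨w, rfl⟩
    rw [← hPZ]
    have : Matrix.toEuclideanLin (projMat U.1 * Z) w =
        Matrix.toEuclideanLin (projMat U.1) (Matrix.toEuclideanLin Z w) := by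
      simp [Matrix.toLpLin_apply, Matrix.mulVec_mulVec]
    rw [this, toEuclideanLin_projMat]
    exact Submodule.starProjection_apply_mem _ _
  rw [projMat_eq_of_isRep hrep, ← Matrix.mul_assoc, norm_mul_transpose_of_orthonormal hZ]
  -- Only the first `d` right singular vectors are kept; on them `X A` becomes `X Z` with columns
  -- scaled by singular values at least `σ_d`.
  refine le_trans ?_ (norm_mul_le_of_orthonormal hF₁ (X * A))
  clear_value Z
  rw [Matrix.mul_assoc, ← hZs, ← Matrix.mul_assoc]
  refine le_of_sq_le_sq ?_ (norm_nonneg _)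
  rw [mul_pow, frobenius_sq, frobenius_sq, Finset.mul_sum]
  refine Finset.sum_le_sum fun i _ => ?_
  rw [Finset.mul_sum]
  refine Finset.sum_le_sum fun j _ => ?_
  rw [Matrix.mul_diagonal, mul_pow, mul_comm (sigma d A ^ 2)]
  exact mul_le_mul_of_nonneg_left (pow_le_pow_left₀ hpos.le (hs j) 2) (sq_nonneg _)

/-! ### The exponential step -/

/-- The two sides agree at `s = 0`, and their difference has derivative `2 (s (u² + w²) + R sin s)`
with `|R| ≤ u² + w²`, which is nonnegative because `|sin s| ≤ s`. -/
theorem sq_mul_cos_add_mul_sin_le (u w : ℝ) {s : ℝ} (hs : 0 ≤ s) :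
    (u * Real.cos s + w * Real.sin s) ^ 2 ≤
      u ^ 2 + 2 * (u * (w * s)) + (u * s) ^ 2 + (w * s) ^ 2 := by
  let k : ℝ → ℝ := fun s => u ^ 2 + 2 * (u * (w * s)) + (u * s) ^ 2 + (w * s) ^ 2 -
    (u * Real.cos s + w * Real.sin s) ^ 2
  have hk : ∀ x, HasDerivAt k (2 * (u * w) + 2 * (u * x) * u + 2 * (w * x) * w -
      2 * (u * Real.cos x + w * Real.sin x) * (u * -Real.sin x + w * Real.cos x)) x := by
    intro x
    have h1 : HasDerivAt (fun x : ℝ => 2 * (u * (w * x))) (2 * (u * w)) x := by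
      simpa using (((hasDerivAt_id x).const_mul w).const_mul u).const_mul 2
    have h2 : HasDerivAt (fun x : ℝ => (u * x) ^ 2) (2 * (u * x) * u) x := by
      simpa using ((hasDerivAt_id x).const_mul u).fun_pow 2
    have h3 : HasDerivAt (fun x : ℝ => (w * x) ^ 2) (2 * (w * x) * w) x := by
      simpa using ((hasDerivAt_id x).const_mul w).fun_pow 2
    have h4 : HasDerivAt (fun x : ℝ => (u * Real.cos x + w * Real.sin x) ^ 2)
        (2 * (u * Real.cos x + w * Real.sin x) * (u * -Real.sin x + w * Real.cos x)) x := by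
      simpa using (((Real.hasDerivAt_cos x).const_mul u).fun_add
        ((Real.hasDerivAt_sin x).const_mul w)).fun_pow 2
    exact (((h1.const_add (u ^ 2)).add h2).add h3).sub h4
  have hmono : MonotoneOn k (Set.Ici 0) := by
    refine monotoneOn_of_deriv_nonneg (convex_Ici 0)
      (fun x _ => (hk x).continuousAt.continuousWithinAt)
      (fun x _ => (hk x).differentiableAt.differentiableWithinAt) fun x hx => ?_
    rw [interior_Ici, Set.mem_Ioi] at hx
    rw [(hk x).deriv]
    set R := 2 * (u * w) * Real.sin x + (u ^ 2 - w ^ 2) * Real.cos x with hR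
    have hsc := Real.sin_sq_add_cos_sq x
    have hRle : |R| ≤ u ^ 2 + w ^ 2 := by
      refine abs_le_of_sq_le_sq ?_ (by positivity)
      have : (u ^ 2 + w ^ 2) ^ 2 - R ^ 2 =
          (2 * (u * w) * Real.cos x - (u ^ 2 - w ^ 2) * Real.sin x) ^ 2 := by
        rw [hR]
        linear_combination (-(u ^ 2 + w ^ 2) ^ 2) * hsc
      nlinarith [sq_nonneg (2 * (u * w) * Real.cos x - (u ^ 2 - w ^ 2) * Real.sin x)]
    have hsin : |Real.sin x| ≤ x := (Real.abs_sin_le_abs).trans_eq (abs_of_pos hx)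
    have hprod : -(x * (u ^ 2 + w ^ 2)) ≤ Real.sin x * R := by
      refine (abs_le.1 ?_).1
      rw [abs_mul]
      exact mul_le_mul hsin hRle (abs_nonneg _) hx.le
    have : 2 * (u * w) + 2 * (u * x) * u + 2 * (w * x) * w -
        2 * (u * Real.cos x + w * Real.sin x) * (u * -Real.sin x + w * Real.cos x) =
        2 * (x * (u ^ 2 + w ^ 2) + Real.sin x * R) := by
      rw [hR]
      linear_combination (-2 * u * w) * hsc
    rw [this]
    linarith
  have h := hmono (Set.mem_Ici.2 le_rfl) (Set.mem_Ici.2 hs) hs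
  simp only [k, Real.cos_zero, Real.sin_zero] at h
  nlinarith

theorem norm_sq_cos_sin_le {n d : ℕ} (A B : Matrix (Fin n) (Fin d) ℝ) {σ : Fin d → ℝ}
    (hσ : ∀ i, 0 ≤ σ i) :
    ‖A * Matrix.diagonal (fun i => Real.cos (σ i)) +
        B * Matrix.diagonal (fun i => Real.sin (σ i))‖ ^ 2 ≤
      ‖A‖ ^ 2 + 2 * (Aᵀ * (B * Matrix.diagonal σ)).trace + ‖A * Matrix.diagonal σ‖ ^ 2 +
        ‖B * Matrix.diagonal σ‖ ^ 2 := by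
  simp only [frobenius_sq, trace_transpose_mul_apply, Finset.mul_sum, ← Finset.sum_add_distrib,
    Matrix.add_apply, Matrix.mul_diagonal]
  exact Finset.sum_le_sum fun i _ => Finset.sum_le_sum fun j _ =>
    sq_mul_cos_add_mul_sin_le _ _ (hσ j)

/-- Columns of `Q₁` that need not be orthonormal are multiplied by a zero singular value. -/
theorem IsCompactSVD.gram {n d : ℕ} {V Q₁ : Matrix (Fin n) (Fin d) ℝ} {σ : Fin d → ℝ}
    {Q₂ : Matrix (Fin d) (Fin d) ℝ} (h : IsCompactSVD V Q₁ σ Q₂) :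
    Vᵀ * V = Q₂ * Matrix.diagonal σ * (Q₂ * Matrix.diagonal σ)ᵀ := by
  obtain ⟨-, -, h₁, rfl⟩ := h
  have : Matrix.diagonal σ * (Q₁ᵀ * Q₁) * Matrix.diagonal σ =
      Matrix.diagonal σ * Matrix.diagonal σ := by
    ext i j
    rw [Matrix.mul_diagonal, Matrix.diagonal_mul, Matrix.diagonal_mul_diagonal,
      Matrix.diagonal_apply]
    by_cases hi : σ i = 0
    · simp [hi]
    by_cases hj : σ j = 0
    · by_cases hij : i = j
      · exact absurd (hij ▸ hj) hi
      · simp [hj, hij]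
    rw [h₁ i j hi hj]
    split_ifs with hij
    · rw [hij, mul_one]
    · simp
  calc _ = Q₂ * (Matrix.diagonal σ * (Q₁ᵀ * Q₁) * Matrix.diagonal σ) * Q₂ᵀ := by
        simp only [Matrix.transpose_mul, Matrix.transpose_transpose, Matrix.diagonal_transpose,
          Matrix.mul_assoc]
    _ = _ := by
        rw [this]
        simp only [Matrix.transpose_mul, Matrix.diagonal_transpose, Matrix.mul_assoc]

/-- Rotating by `Q₂` changes no norm, so the scalar inequality applies to each entry in the singular
basis. The bound contains `Q₁` and `σ` only through `Q₁ Σ = V Q₂` and `Q₂ Σ² Q₂ᵀ = Vᵀ V`, so it can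
be written in `V` alone. -/
theorem chordalDist_sq_exp_le {n d : ℕ} {Y V : Matrix (Fin n) (Fin d) ℝ} {X X' : Gr n d}
    (hY : IsRep Y X) (hX' : IsExp Y V X') (U : Gr n d) :
    chordalDist X' U ^ 2 ≤ chordalDist X U ^ 2 +
      2 * ((projPerpMat U.1 * Y)ᵀ * (projPerpMat U.1 * V)).trace +
      ‖projPerpMat U.1 * Y * Vᵀ‖ ^ 2 + ‖projPerpMat U.1 * V‖ ^ 2 := by
  obtain ⟨Q₁, σ, Q₂, hsvd, hrep⟩ := hX'
  obtain ⟨hQ₂, hσ, -, hV⟩ := id hsvd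
  have hQ₂' : Q₂ * Q₂ᵀ = 1 := mul_eq_one_comm.1 hQ₂
  rw [chordalDist_sq_eq_of_isRep hrep, chordalDist_sq_eq_of_isRep hY]
  set P := projPerpMat U.1
  have hB : P * Q₁ * Matrix.diagonal σ = P * V * Q₂ := by
    rw [hV]
    calc _ = P * Q₁ * Matrix.diagonal σ * (Q₂ᵀ * Q₂) := by rw [hQ₂, Matrix.mul_one]
      _ = _ := by simp only [Matrix.mul_assoc]
  have h1 : ‖P * Y * Q₂‖ = ‖P * Y‖ := by
    rw [← norm_mul_transpose_of_orthonormal hQ₂, Matrix.mul_assoc, hQ₂', Matrix.mul_one]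
  have h2 : ‖P * V * Q₂‖ = ‖P * V‖ := by
    rw [← norm_mul_transpose_of_orthonormal hQ₂, Matrix.mul_assoc, hQ₂', Matrix.mul_one]
  have h3 : ((P * Y * Q₂)ᵀ * (P * V * Q₂)).trace = ((P * Y)ᵀ * (P * V)).trace := by
    rw [Matrix.transpose_mul (P * Y) Q₂, Matrix.trace_mul_comm, Matrix.mul_assoc (P * V),
      ← Matrix.mul_assoc Q₂, hQ₂', Matrix.one_mul, Matrix.trace_mul_comm]
  have h4 : ‖P * Y * Q₂ * Matrix.diagonal σ‖ ^ 2 = ‖P * Y * Vᵀ‖ ^ 2 := by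
    rw [frobenius_sq_eq_trace', frobenius_sq_eq_trace']
    congr 1
    calc _ = P * Y * (Q₂ * Matrix.diagonal σ * (Q₂ * Matrix.diagonal σ)ᵀ) * (P * Y)ᵀ := by
          simp only [Matrix.transpose_mul, Matrix.mul_assoc]
      _ = _ := by
          rw [← hsvd.gram]
          simp only [Matrix.transpose_mul, Matrix.transpose_transpose, Matrix.mul_assoc]
  have hmain := norm_sq_cos_sin_le (P * Y * Q₂) (P * Q₁) hσ
  rw [hB, h1, h2, h3, h4] at hmain
  refine le_of_eq_of_le ?_ hmain
  rw [← Matrix.mul_assoc, norm_mul_transpose_of_orthonormal hQ₂, Matrix.mul_add]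
  simp only [Matrix.mul_assoc]

/-! ### The gradient direction of the cost -/

/-- Both squares equal `tr (P Q) - tr (P Q P Q)`, which is symmetric in `P` and `Q`. -/
theorem norm_perp_mul_mul_eq {n : ℕ} {P Q : Matrix (Fin n) (Fin n) ℝ} (hP : IsOrthProj P)
    (hQ : IsOrthProj Q) : ‖(1 - Q) * P * Q‖ = ‖(1 - P) * Q * P‖ := by
  have key : ∀ {P Q : Matrix (Fin n) (Fin n) ℝ}, IsOrthProj P → IsOrthProj Q →
      ‖(1 - P) * Q * P‖ ^ 2 = (P * Q).trace - (P * Q * (P * Q)).trace := by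
    intro P Q hP hQ
    rw [Matrix.mul_assoc, hP.compl.norm_sq_mul, Matrix.transpose_mul, hP.transpose, hQ.transpose]
    have : P * Q * (1 - P) * (Q * P) = P * (Q * Q) * P - P * Q * P * (Q * P) := by
      noncomm_ring
    rw [this, hQ.idem, Matrix.trace_sub, Matrix.trace_mul_comm (P * Q), ← Matrix.mul_assoc P P,
      hP.idem, Matrix.trace_mul_comm (P * Q * P), Matrix.mul_assoc Q P, ← Matrix.mul_assoc P (P * Q),
      ← Matrix.mul_assoc P P, hP.idem, Matrix.trace_mul_comm Q, Matrix.mul_assoc (P * Q)]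
  refine (sq_eq_sq₀ (norm_nonneg _) (norm_nonneg _)).1 ?_
  rw [key hQ hP, key hP hQ, Matrix.trace_mul_comm Q P]
  congr 1
  rw [Matrix.mul_assoc Q, Matrix.trace_mul_comm Q]
  simp only [Matrix.mul_assoc]

section GradientDirection

variable {n d m : ℕ} {P : Matrix (Fin n) (Fin n) ℝ} {Y : Matrix (Fin n) (Fin d) ℝ}
  {A : Matrix (Fin n) (Fin m) ℝ} {N : Matrix (Fin n) (Fin n) ℝ}

theorem perp_mul_perp_mul (hP : IsOrthProj P) (hA : P * A = A) (Q : Matrix (Fin n) (Fin n) ℝ) :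
    (1 - P) * (1 - Q) * A = -((1 - P) * Q * P * A) := by
  have h0 : (1 - P) * P = 0 := by rw [sub_mul, one_mul, hP.idem, sub_self]
  calc (1 - P) * (1 - Q) * A = (1 - P) * (1 - Q) * (P * A) := by rw [hA]
    _ = ((1 - P) * P - (1 - P) * Q * P) * A := by rw [← Matrix.mul_assoc]; congr 1; noncomm_ring
    _ = _ := by rw [h0, zero_sub, Matrix.neg_mul]

theorem norm_perp_mul_direction_le (hP : IsOrthProj P) (hY : Yᵀ * Y = 1) (hA : P * A = A) :
    ‖(1 - P) * ((1 - Y * Yᵀ) * ((A * Aᵀ + N) * Y))‖ ≤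
      ‖(1 - P) * (Y * Yᵀ) * P * A * Aᵀ‖ + ‖N‖ := by
  have : (1 - P) * ((1 - Y * Yᵀ) * ((A * Aᵀ + N) * Y)) =
      (-((1 - P) * (Y * Yᵀ) * P * A * Aᵀ) + (1 - P) * ((1 - Y * Yᵀ) * N)) * Y := by
    have h := perp_mul_perp_mul hP hA (Y * Yᵀ)
    calc _ = ((1 - P) * (1 - Y * Yᵀ) * A * Aᵀ + (1 - P) * ((1 - Y * Yᵀ) * N)) * Y := by
          simp only [Matrix.mul_assoc, Matrix.add_mul, Matrix.mul_add]
      _ = _ := by rw [h, Matrix.neg_mul]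
  rw [this]
  refine (norm_mul_le_of_orthonormal hY _).trans ((norm_add_le _ _).trans ?_)
  rw [norm_neg]
  gcongr
  exact (hP.compl.norm_mul_le _).trans ((isOrthProj_mul_transpose hY).compl.norm_mul_le _)

theorem norm_perp_mul_rep_mul_direction_transpose_le (hP : IsOrthProj P) (hY : Yᵀ * Y = 1)
    (hA : P * A = A) (hN : Nᵀ = N) :
    ‖(1 - P) * Y * ((1 - Y * Yᵀ) * ((A * Aᵀ + N) * Y))ᵀ‖ ≤
      ‖(1 - P) * (Y * Yᵀ) * P * A * Aᵀ‖ + ‖N‖ := by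
  have hQ := isOrthProj_mul_transpose hY
  have : (1 - P) * Y * ((1 - Y * Yᵀ) * ((A * Aᵀ + N) * Y))ᵀ =
      ((1 - P) * (Y * Yᵀ) * P * A * Aᵀ + (1 - P) * ((Y * Yᵀ) * N)) * (1 - Y * Yᵀ) := by
    rw [Matrix.transpose_mul, hQ.compl.transpose, Matrix.transpose_mul, Matrix.transpose_add,
      Matrix.transpose_mul, Matrix.transpose_transpose, hN, Matrix.mul_assoc _ P A, hA]
    simp only [Matrix.mul_assoc, Matrix.add_mul, Matrix.mul_add]
  rw [this]
  refine (hQ.compl.norm_mul_le' _).trans ((norm_add_le _ _).trans ?_)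
  gcongr
  exact (hP.compl.norm_mul_le _).trans (hQ.norm_mul_le _)

theorem trace_perp_mul_direction_le (hP : IsOrthProj P) (hY : Yᵀ * Y = 1) (hA : P * A = A) :
    (((1 - P) * Y)ᵀ * ((1 - P) * ((1 - Y * Yᵀ) * ((A * Aᵀ + N) * Y)))).trace ≤
      -‖(1 - P) * (Y * Yᵀ) * P * A‖ ^ 2 + ‖(1 - P) * (Y * Yᵀ) * P‖ * ‖N‖ := by
  have hQ := isOrthProj_mul_transpose hY
  obtain ⟨Q, hQdef⟩ : ∃ Q, Q = Y * Yᵀ := ⟨_, rfl⟩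
  rw [← hQdef] at hQ ⊢
  have hsplit : (((1 - P) * Y)ᵀ * ((1 - P) * ((1 - Q) * ((A * Aᵀ + N) * Y)))).trace =
      (Q * ((1 - P) * (1 - Q) * A) * Aᵀ).trace + (((1 - Q) * (1 - P) * Q)ᵀ * N).trace := by
    calc _ = (Yᵀ * ((1 - P) * (1 - P) * (1 - Q) * (A * Aᵀ + N) * Y)).trace := by
          rw [Matrix.transpose_mul, hP.compl.transpose]
          simp only [Matrix.mul_assoc]
      _ = (Q * ((1 - P) * (1 - Q) * (A * Aᵀ + N))).trace := by
          rw [hP.compl.idem, Matrix.trace_mul_comm, Matrix.mul_assoc, ← hQdef,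
            Matrix.trace_mul_comm]
      _ = _ := by
          rw [Matrix.transpose_mul, Matrix.transpose_mul, hQ.transpose, hP.compl.transpose,
            hQ.compl.transpose, ← Matrix.trace_add]
          simp only [Matrix.mul_assoc, Matrix.mul_add]
  rw [hsplit, perp_mul_perp_mul hP hA]
  refine add_le_add (le_of_eq ?_) ?_
  · have hLA : ((1 - P) * Q * P * A)ᵀ = Aᵀ * Q * (1 - P) := by
      rw [Matrix.mul_assoc _ P A, hA, Matrix.transpose_mul, Matrix.transpose_mul,
        hP.compl.transpose, hQ.transpose, Matrix.mul_assoc]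
    have hPL : (1 - P) * ((1 - P) * Q * P * A) = (1 - P) * Q * P * A := by
      simp only [← Matrix.mul_assoc, hP.compl.idem]
    rw [frobenius_sq_eq_trace, hLA, Matrix.mul_assoc _ (1 - P), hPL, Matrix.mul_neg,
      Matrix.neg_mul, Matrix.trace_neg, Matrix.trace_mul_comm _ Aᵀ]
    simp only [Matrix.mul_assoc]
  -- The matrix paired with `N` is `-(1 - Q) P Q`, which has the same norm as `(1 - P) Q P`; the
  -- noise thus enters with a factor that vanishes at the target.
  · refine (trace_transpose_mul_le _ _).trans ?_
    have hQQ : (1 - Q) * Q = 0 := by rw [sub_mul, one_mul, hQ.idem, sub_self]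
    have : (1 - Q) * (1 - P) * Q = -((1 - Q) * P * Q) := by
      calc _ = (1 - Q) * Q - (1 - Q) * P * Q := by noncomm_ring
        _ = _ := by rw [hQQ, zero_sub]
    rw [this, norm_neg, norm_perp_mul_mul_eq hP hQ]

end GradientDirection

/-! ### One gradient step with noisy data -/

theorem norm_mul_transpose_sub_le {n m : ℕ} (W A E : Matrix (Fin n) (Fin m) ℝ)
    (hW : W = A + E) {s δ : ℝ} (hA : sigma 1 A ≤ s) (hE : ‖E‖ ≤ δ) :
    ‖W * Wᵀ - A * Aᵀ‖ ≤ 2 * s * δ + δ ^ 2 := by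
  have hδ : 0 ≤ δ := (norm_nonneg _).trans hE
  have hs : 0 ≤ s := (sigma_nonneg _ _).trans hA
  have heq : W * Wᵀ - A * Aᵀ = A * Eᵀ + E * Aᵀ + E * Eᵀ := by
    rw [hW, Matrix.transpose_add, Matrix.add_mul, Matrix.mul_add, Matrix.mul_add]
    abel
  have h1 : ‖A * Eᵀ‖ ≤ s * δ := (norm_mul_le_sigma_one A _).trans (by
    rw [Matrix.frobenius_norm_transpose]; gcongr)
  have h2 : ‖E * Aᵀ‖ ≤ s * δ := (norm_mul_transpose_le_sigma_one A _).trans (by gcongr)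
  have h3 : ‖E * Eᵀ‖ ≤ δ * δ := (Matrix.frobenius_norm_mul _ _).trans (by
    rw [Matrix.frobenius_norm_transpose]; gcongr)
  rw [heq]
  linarith [norm_add_le (A * Eᵀ + E * Aᵀ) (E * Eᵀ), norm_add_le (A * Eᵀ) (E * Aᵀ)]

/-- The right-hand side does not involve `Y`, so the representation used for the gradient may differ
from the one in which the step was computed. -/
theorem norm_sq_riemGrad_chordalDist_sq {n d : ℕ} (U : Gr n d)
    {Y : Matrix (Fin n) (Fin d) ℝ} {X : Gr n d} (hY : IsRep Y X) :
    ‖riemGrad (fun X => chordalDist X U ^ 2) Y‖ ^ 2 =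
      4 * ‖(1 - projMat U.1) * projMat X.1 * projMat U.1‖ ^ 2 := by
  rw [riemGrad_chordalDist_sq U hY, ← norm_perp_mul_mul_eq (isOrthProj_projMat U)
    (isOrthProj_projMat X), Matrix.mul_smul, norm_smul, mul_pow, ← Matrix.mul_assoc,
    ← norm_mul_transpose_of_orthonormal hY.1, Matrix.mul_assoc _ Y, ← projMat_eq_of_isRep hY]
  norm_num

/-- Decay of the squared chordal distance along one gradient step, for data with noise level
`δ`. -/
theorem chordalDist_sq_gradStep_le {n d T : ℕ} (hd : 1 ≤ d) (hT : d ≤ T) {U X X' : Gr n d}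
    {W : Matrix (Fin n) (Fin T) ℝ} {α σlow σup r δ : ℝ} (hα : 0 < α) (hσlow : 0 < σlow)
    (hup : sigma 1 (projMat U.1 * W) ≤ σup) (hlow : σlow ≤ sigma d (projMat U.1 * W))
    (hδ : ‖projPerpMat U.1 * W‖ ≤ δ) (hstep : IsGradStep α W X X') (hr : chordalDist X U ≤ r)
    {Y : Matrix (Fin n) (Fin d) ℝ} (hY : IsRep Y X) :
    chordalDist X' U ^ 2 ≤ chordalDist X U ^ 2 -
      (α * σlow ^ 2 - 2 * α ^ 2 * σup ^ 4) *
        ‖riemGrad (fun X => chordalDist X U ^ 2) Y‖ ^ 2 + gammaPoly α σup r δ := by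
  obtain ⟨Y₀, hY₀, hexp⟩ := hstep
  rw [norm_sq_riemGrad_chordalDist_sq U hY]
  have hP := isOrthProj_projMat U
  have hmain := chordalDist_sq_exp_le hY₀ hexp U
  rw [riemGrad_cost W hY₀] at hmain
  obtain ⟨A, hA⟩ : ∃ A, A = projMat U.1 * W := ⟨_, rfl⟩
  rw [← hA] at hup hlow
  have hPA : projMat U.1 * A = A := by rw [hA, ← Matrix.mul_assoc, hP.idem]
  obtain ⟨N, hN⟩ : ∃ N, N = W * Wᵀ - A * Aᵀ := ⟨_, rfl⟩
  have hNt : Nᵀ = N := by simp [hN]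
  have hNle : ‖N‖ ≤ 2 * σup * δ + δ ^ 2 := by
    rw [hN]
    exact norm_mul_transpose_sub_le W A (projPerpMat U.1 * W)
      (by rw [hA, projPerpMat, Matrix.sub_mul, Matrix.one_mul]; abel) hup hδ
  have hdir : -(α • ((1 - projMat X.1) * ((-2 : ℝ) • (W * Wᵀ * Y₀)))) =
      (2 * α) • ((1 - Y₀ * Y₀ᵀ) * ((A * Aᵀ + N) * Y₀)) := by
    rw [hN, add_sub_cancel, projMat_eq_of_isRep hY₀, Matrix.mul_smul, smul_smul, ← neg_smul]
    congr 1
    ring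
  rw [hdir, projPerpMat] at hmain
  simp only [Matrix.mul_smul, Matrix.transpose_smul, Matrix.trace_smul, norm_smul,
    smul_eq_mul, Real.norm_of_nonneg (show 0 ≤ 2 * α by positivity)] at hmain
  have h1 := norm_perp_mul_direction_le (N := N) hP hY₀.1 hPA
  have h2 := norm_perp_mul_rep_mul_direction_transpose_le hP hY₀.1 hPA hNt
  have h3 := trace_perp_mul_direction_le (N := N) hP hY₀.1 hPA
  rw [← projMat_eq_of_isRep hY₀] at hmain h1 h2 h3
  set L := (1 - projMat U.1) * projMat X.1 * projMat U.1 with hL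
  have hσup : 0 < σup := hσlow.trans_le (hlow.trans ((sigma_antitone hd A).trans hup))
  have hLA : ‖L * A * Aᵀ‖ ≤ σup ^ 2 * ‖L‖ := by
    calc ‖L * A * Aᵀ‖ ≤ σup * ‖L * A‖ :=
          (norm_mul_transpose_le_sigma_one A _).trans (by gcongr)
      _ ≤ σup * (σup * ‖L‖) := by
          gcongr
          exact (norm_mul_le_sigma_one' A _).trans (by gcongr)
      _ = _ := by ring
  have hLlow : σlow * ‖L‖ ≤ ‖L * A‖ := by
    have h := sigma_mul_norm_mul_projMat_le hT hPA (hσlow.trans_le hlow) L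
    rw [hL, Matrix.mul_assoc _ (projMat U.1) (projMat U.1), hP.idem, ← hL] at h
    exact (by gcongr : σlow * ‖L‖ ≤ sigma d A * ‖L‖).trans h
  -- Dropping the last factor `P` of `L` leaves `(1 - P) Q`, whose norm is the chordal distance.
  have hLr : ‖L‖ ≤ r := by
    refine (hP.norm_mul_le' _).trans (le_trans (le_of_eq ?_) hr)
    rw [chordalDist_comm, chordalDist_eq_norm, projPerpMat]
  have hlow2 : σlow ^ 2 * ‖L‖ ^ 2 ≤ ‖L * A‖ ^ 2 := by
    rw [← mul_pow]
    exact pow_le_pow_left₀ (by positivity) hLlow 2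
  obtain ⟨ν, hν⟩ : ∃ ν, ν = 2 * σup * δ + δ ^ 2 := ⟨_, rfl⟩
  rw [← hν] at hNle
  have hν0 : 0 ≤ ν := (norm_nonneg _).trans hNle
  have hL0 := norm_nonneg L
  have hb1 := pow_le_pow_left₀ (norm_nonneg _) (h1.trans (add_le_add hLA hNle)) 2
  have hb2 := pow_le_pow_left₀ (norm_nonneg _) (h2.trans (add_le_add hLA hNle)) 2
  have hb3 := mul_le_mul_of_nonneg_left hNle hL0
  -- `γ_r` is a quadratic polynomial in the bound `ν` for `‖N‖`.
  have hγ : gammaPoly α σup r δ =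
      4 * α * (r * ν) + 16 * α ^ 2 * σup ^ 2 * (r * ν) + 8 * α ^ 2 * ν ^ 2 := by
    rw [gammaPoly, hν]
    ring
  have hrν : ‖L‖ * ν ≤ r * ν := mul_le_mul_of_nonneg_right hLr hν0
  have e1 := mul_le_mul_of_nonneg_left hb1 (show 0 ≤ (2 * α) ^ 2 by positivity)
  have e2 := mul_le_mul_of_nonneg_left hb2 (show 0 ≤ (2 * α) ^ 2 by positivity)
  have e3 := mul_le_mul_of_nonneg_left (h3.trans (add_le_add (neg_le_neg hlow2) hb3))
    (show 0 ≤ 4 * α by positivity)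
  have e4 := mul_le_mul_of_nonneg_left hrν (show 0 ≤ 4 * α by positivity)
  have e5 := mul_le_mul_of_nonneg_left hrν (show 0 ≤ 16 * α ^ 2 * σup ^ 2 by positivity)
  rw [hγ]
  simp only [mul_pow] at hmain e1 e2
  linarith

/-! ### The noise level of the data window -/

theorem isClassKInf_gammaPoly {α σup r : ℝ} (hα : 0 < α) (hσ : 0 < σup) (hr : 0 < r) :
    IsClassKInf (gammaPoly α σup r) := by
  have hmono : StrictMonoOn (gammaPoly α σup r) (Set.Ici 0) := by
    intro x hx y hy hxy
    have hx : 0 ≤ x := hx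
    have h2 : x ^ 2 ≤ y ^ 2 := pow_le_pow_left₀ hx hxy.le 2
    have h3 : x ^ 3 ≤ y ^ 3 := pow_le_pow_left₀ hx hxy.le 3
    have h4 : x ^ 4 ≤ y ^ 4 := pow_le_pow_left₀ hx hxy.le 4
    unfold gammaPoly
    -- The linear term alone supplies strictness; the other terms are merely monotone.
    have h1 : 8 * α * r * σup * (1 + 4 * α * σup ^ 2) * x <
        8 * α * r * σup * (1 + 4 * α * σup ^ 2) * y := by gcongr
    gcongr
  have h0 : gammaPoly α σup r 0 = 0 := by simp [gammaPoly]
  refine ⟨?_, hmono, fun x hx => ?_, h0, ?_⟩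
  · unfold gammaPoly
    fun_prop
  · rw [← h0]
    exact hmono.monotoneOn (Set.mem_Ici.2 le_rfl) hx hx
  · refine Filter.tendsto_atTop_mono' _ ?_
      (Filter.tendsto_id.const_mul_atTop
        (show 0 < 8 * α * r * σup * (1 + 4 * α * σup ^ 2) by positivity))
    filter_upwards [Filter.eventually_ge_atTop 0] with x hx
    simp only [gammaPoly, id]
    have : 0 ≤ (4 * α * r + 16 * α ^ 2 * σup ^ 2 * (r + 2)) * x ^ 2 +
      32 * α ^ 2 * σup * x ^ 3 + 8 * α ^ 2 * x ^ 4 := by positivity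
    linarith

theorem chordalDist_add_le {n d : ℕ} {U : ℕ → Gr n d} {c : ℝ}
    (hvar : ∀ t, 1 ≤ t → chordalDist (U t) (U (t + 1)) ≤ c) {s : ℕ} (hs : 1 ≤ s) (k : ℕ) :
    chordalDist (U s) (U (s + k)) ≤ c * k := by
  induction k with
  | zero => simp [chordalDist_self]
  | succ k ih =>
    refine (chordalDist_triangle _ (U (s + k)) _).trans ?_
    push_cast
    rw [← add_assoc]
    linarith [hvar (s + k) (by omega)]

theorem norm_replicateCol_eq {n : ℕ} (v : EuclideanSpace ℝ (Fin n)) :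
    ‖Matrix.replicateCol (Fin 1) v.ofLp‖ = ‖v‖ := by
  refine (sq_eq_sq₀ (norm_nonneg _) (norm_nonneg _)).1 ?_
  rw [frobenius_sq, EuclideanSpace.norm_sq_eq]
  simp

/-- The signal part is damped by `‖P_U^⊥ P_V‖ ≤ κ` and has norm at most `‖u‖ + ε`; the noise adds
`ε`. Vectors are one-column matrices here so that the Frobenius estimates apply. -/
theorem norm_projPerpMat_mul_replicateCol_le {n d : ℕ} (U V : Gr n d)
    {u x e : EuclideanSpace ℝ (Fin n)} {κ ε : ℝ} (hu : u = x + e) (hx : x ∈ V.1) (he : ‖e‖ ≤ ε)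
    (hUV : chordalDist U V ≤ κ) :
    ‖projPerpMat U.1 * Matrix.replicateCol (Fin 1) u.ofLp‖ ≤ κ * ‖u‖ + ε * (κ + 1) := by
  have hκ : 0 ≤ κ := (chordalDist_nonneg _ _).trans hUV
  have hVx : projMat V.1 * Matrix.replicateCol (Fin 1) x.ofLp =
      Matrix.replicateCol (Fin 1) x.ofLp := by
    have h := toEuclideanLin_projMat V x
    rw [Submodule.starProjection_eq_self_iff.2 hx] at h
    have h2 := congrArg WithLp.ofLp h
    rw [Matrix.toLpLin_apply] at h2
    rw [← Matrix.replicateCol_mulVec]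
    exact congrArg _ h2
  have hsplit : projPerpMat U.1 * Matrix.replicateCol (Fin 1) u.ofLp =
      projPerpMat U.1 * projMat V.1 * Matrix.replicateCol (Fin 1) x.ofLp +
        projPerpMat U.1 * Matrix.replicateCol (Fin 1) e.ofLp := by
    rw [Matrix.mul_assoc, hVx, ← Matrix.mul_add, hu]
    rfl
  have hxu : ‖x‖ ≤ ‖u‖ + ε := by
    have : x = u - e := by rw [hu, add_sub_cancel_right]
    rw [this]
    exact (norm_sub_le _ _).trans (by gcongr)
  have h1 : ‖projPerpMat U.1 * projMat V.1 * Matrix.replicateCol (Fin 1) x.ofLp‖ ≤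
      κ * (‖u‖ + ε) := by
    refine (Matrix.frobenius_norm_mul _ _).trans ?_
    rw [← chordalDist_eq_norm, norm_replicateCol_eq]
    exact mul_le_mul hUV hxu (norm_nonneg _) hκ
  have h2 : ‖projPerpMat U.1 * Matrix.replicateCol (Fin 1) e.ofLp‖ ≤ ε := by
    refine ((isOrthProj_projMat U).compl.norm_mul_le _).trans ?_
    rw [norm_replicateCol_eq]
    exact he
  rw [hsplit]
  refine (norm_add_le _ _).trans ?_
  linarith

/-- Minkowski's inequality in `ℝᵐ` for the vectors of column norms; the constant vector contributes
`√m`. -/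
theorem norm_le_of_col_le {n m : ℕ} {E B : Matrix (Fin n) (Fin m) ℝ} {ε κ : ℝ} (hε : 0 ≤ ε)
    (hκ : 0 ≤ κ)
    (h : ∀ j, √(∑ i, E i j ^ 2) ≤ √(∑ i, B i j ^ 2) + ε * κ) :
    ‖E‖ ≤ ‖B‖ + ε * √(m : ℝ) * κ := by
  have hnorm : ∀ A : Matrix (Fin n) (Fin m) ℝ,
      ‖A‖ = ‖(WithLp.toLp 2 fun j => √(∑ i, A i j ^ 2) : EuclideanSpace ℝ (Fin m))‖ := by
    intro A
    refine (sq_eq_sq₀ (norm_nonneg _) (norm_nonneg _)).1 ?_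
    rw [frobenius_sq, EuclideanSpace.norm_sq_eq, Finset.sum_comm]
    refine Finset.sum_congr rfl fun j _ => ?_
    rw [Real.norm_eq_abs, sq_abs, Real.sq_sqrt (by positivity)]
  have hconst : ‖(WithLp.toLp 2 fun _ => ε * κ : EuclideanSpace ℝ (Fin m))‖ = ε * √(m : ℝ) * κ := by
    rw [EuclideanSpace.norm_eq]
    simp only [Real.norm_eq_abs, sq_abs, Finset.sum_const, Finset.card_univ, Fintype.card_fin,
      nsmul_eq_mul]
    rw [Real.sqrt_mul (by positivity), Real.sqrt_sq (by positivity)]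
    ring
  rw [← hconst, hnorm E, hnorm B]
  refine le_trans ?_ (norm_add_le _ _)
  rw [EuclideanSpace.norm_eq, EuclideanSpace.norm_eq]
  refine Real.sqrt_le_sqrt (Finset.sum_le_sum fun j _ => ?_)
  rw [Real.norm_eq_abs, Real.norm_eq_abs]
  refine pow_le_pow_left₀ (abs_nonneg _) ?_ 2
  rw [abs_of_nonneg (Real.sqrt_nonneg _)]
  exact (h j).trans (le_abs_self _)

theorem norm_projPerpMat_mul_dataMat_le {n d T : ℕ} {U : ℕ → Gr n d}
    {u : ℕ → EuclideanSpace ℝ (Fin n)} {ε c : ℝ}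
    (hmeas : ∀ t, 1 ≤ t → ∃ ubar e : EuclideanSpace ℝ (Fin n),
      u t = ubar + e ∧ ubar ∈ (U t).1 ∧ ‖e‖ ≤ ε)
    (hc : 0 ≤ c) (hvar : ∀ t, 1 ≤ t → chordalDist (U t) (U (t + 1)) ≤ c) {t : ℕ} (ht : T ≤ t)
    (hT : 1 ≤ T) :
    ‖projPerpMat (U t).1 * dataMat u T t‖ ≤ noiseBound u c ε T t := by
  have hε : 0 ≤ ε := by
    obtain ⟨_, e, -, -, he⟩ := hmeas 1 le_rfl
    exact (norm_nonneg e).trans he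
  have hT' : (1 : ℝ) ≤ T := by exact_mod_cast hT
  set D := Matrix.diagonal (fun j : Fin T => (T : ℝ) - 1 - (j : ℕ)) with hD
  have hcn : c * ‖dataMat u T t * D‖ = ‖c • (dataMat u T t * D)‖ := by
    rw [norm_smul, Real.norm_of_nonneg hc]
  rw [noiseBound, ← hD, hcn]
  refine norm_le_of_col_le hε (by nlinarith) fun j => ?_
  have hj : ((j : ℕ) : ℝ) + 1 ≤ T := by exact_mod_cast j.2
  obtain ⟨s, hs⟩ : ∃ s, s = t + 1 + (j : ℕ) - T := ⟨_, rfl⟩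
  have hs1 : 1 ≤ s := by omega
  -- The age of column `j`: it was measured at time `s = t - k`, and `k` is also the diagonal entry
  -- of `D`.
  obtain ⟨k, hk⟩ : ∃ k, k = T - 1 - (j : ℕ) := ⟨_, rfl⟩
  have hkR : (k : ℝ) = T - 1 - (j : ℕ) := by
    have : k + 1 + j = T := by omega
    have h : (k : ℝ) + 1 + (j : ℕ) = T := by exact_mod_cast this
    linarith
  have hsk : s + k = t := by omega
  obtain ⟨x, e, hu, hx, he⟩ := hmeas s hs1
  have hdist : chordalDist (U t) (U s) ≤ c * k := by
    rw [chordalDist_comm, ← hsk]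
    exact chordalDist_add_le hvar hs1 k
  have hcol := norm_projPerpMat_mul_replicateCol_le (U t) (U s) hu hx he hdist
  have h1 : ‖projPerpMat (U t).1 * Matrix.replicateCol (Fin 1) (u s).ofLp‖ =
      √(∑ i, (projPerpMat (U t).1 * dataMat u T t) i j ^ 2) := by
    rw [← Real.sqrt_sq (norm_nonneg _), frobenius_sq]
    simp [Matrix.mul_apply, dataMat, hs]
  have h2 : c * k * ‖u s‖ = √(∑ i, (c • (dataMat u T t * D)) i j ^ 2) := by
    have : ∀ i, (c • (dataMat u T t * D)) i j ^ 2 = (c * k) ^ 2 * u s i ^ 2 := by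
      intro i
      rw [Matrix.smul_apply, hD, Matrix.mul_diagonal, ← hkR, dataMat, Matrix.of_apply, ← hs,
        smul_eq_mul]
      ring
    rw [Finset.sum_congr rfl fun i _ => this i, ← Finset.mul_sum, Real.sqrt_mul (by positivity),
      Real.sqrt_sq (by positivity), EuclideanSpace.norm_eq]
    simp
  rw [← h1, ← h2]
  refine hcol.trans ?_
  gcongr
  rw [hkR]
  have : (0 : ℝ) ≤ (j : ℕ) := Nat.cast_nonneg _
  linarith

end GrassmannTracking

end

theorem lemma3 {n d T K : ℕ} (hd : 1 ≤ d) (hT : d ≤ T)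
    (U : ℕ → GrassmannTracking.Gr n d) (u : ℕ → EuclideanSpace ℝ (Fin n))
    (ε c σlow σup : ℝ)
    -- bounded measurement error
    (hmeas : ∀ t, 1 ≤ t → ∃ ubar e : EuclideanSpace ℝ (Fin n),
      u t = ubar + e ∧ ubar ∈ (U t).1 ∧ ‖e‖ ≤ ε)
    -- bounded variation of the subspace
    (hc : 0 ≤ c) (hvar : ∀ t, 1 ≤ t → GrassmannTracking.chordalDist (U t) (U (t + 1)) ≤ c)
    -- bounds on the singular values of the signal component
    (hσlow : 0 < σlow) (hσ : σlow ≤ σup)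
    (hup : ∀ t, T ≤ t → GrassmannTracking.sigma 1
      (GrassmannTracking.projMat (U t).1 * GrassmannTracking.dataMat u T t) ≤ σup)
    (hlow : ∀ t, T ≤ t → σlow ≤ GrassmannTracking.sigma d
      (GrassmannTracking.projMat (U t).1 * GrassmannTracking.dataMat u T t))
    -- the gradient descent iterates, with step size `α`
    (α : ℝ) (hα : 0 < α) (Uhat : ℕ → ℕ → GrassmannTracking.Gr n d)
    (hstep : ∀ t, T ≤ t → ∀ k, k < K → GrassmannTracking.IsGradStep α
      (GrassmannTracking.dataMat u T t) (Uhat t k) (Uhat t (k + 1)))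
    (r : ℝ) (hr : 0 < r) :
    GrassmannTracking.IsClassKInf (GrassmannTracking.gammaPoly α σup r) ∧
    ∀ t, T ≤ t → 0 ≤ GrassmannTracking.noiseBound u c ε T t ∧
      ∀ k, k < K → Uhat t k ∈ GrassmannTracking.chordalBall r (U t) →
        ∀ Y : Matrix (Fin n) (Fin d) ℝ, GrassmannTracking.IsRep Y (Uhat t k) →
          GrassmannTracking.chordalDist (Uhat t (k + 1)) (U t) ^ 2 ≤
            GrassmannTracking.chordalDist (Uhat t k) (U t) ^ 2 -
              (α * σlow ^ 2 - 2 * α ^ 2 * σup ^ 4) *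
                ‖GrassmannTracking.riemGrad
                  (fun X => GrassmannTracking.chordalDist X (U t) ^ 2) Y‖ ^ 2 +
              GrassmannTracking.gammaPoly α σup r
                (GrassmannTracking.noiseBound u c ε T t) := by
  have hσup : 0 < σup := hσlow.trans_le hσ
  refine ⟨GrassmannTracking.isClassKInf_gammaPoly hα hσup hr, fun t ht => ?_⟩
  have hnoise := GrassmannTracking.norm_projPerpMat_mul_dataMat_le hmeas hc hvar ht (hd.trans hT)
  exact ⟨(norm_nonneg _).trans hnoise, fun k hk hball Y hY =>
    GrassmannTracking.chordalDist_sq_gradStep_le hd hT hα hσlow (hup t ht) (hlow t ht) hnoise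
      (hstep t ht k hk)
      (by rw [GrassmannTracking.chordalDist_comm]; exact hball) hY⟩
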